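/- Let $K$ be a field and let $n, k$ be integers with $n \ge 3$ and $3 \le k \le n$. Let $\mathrm{UT}_n(K)$ be the group of lower unitriangular $n \times n$ matrices over $K$ (ones on the diagonal, zeros above it), let $\gamma_1(G) = G$, $\gamma_{m+1}(G) = [\gamma_m(G), G]$ denote the lower central series of a group $G$, and put $\Gamma_{n,k} = \mathrm{UT}_n(K)/\gamma_k(\mathrm{UT}_n(K))$. Let $\operatorname{Aut}_c(\Gamma_{n,k})$ be the group of all class preserving automorphisms of $\Gamma_{n,k}$, i.e. those automorphisms that map every element to a conjugate of itself, and let $\operatorname{Inn}(\Gamma_{n,k})$ be the group of inner automorphisms. Then $\operatorname{Aut}_c(\Gamma_{n,k}) = \operatorname{Inn}(\Gamma_{n,k})$ if and only if $K$ is a prime field, i.e. $K$ has no proper subfield (equivalently, $K \cong \mathbb{F}_p$ for a prime $p$ or $K \cong \mathbb{Q}$). -/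

import Mathlib

/-- The group `UT_n(R)` of lower unitriangular `n × n` matrices over a commutative ring `R`,
as a subgroup of `GL_n(R)`: ones on the diagonal, zeros above it. -/
def UT (n : ℕ) (R : Type*) [CommRing R] : Subgroup (GL (Fin n) R) where
  carrier := {g | (∀ i, g.val i i = 1) ∧ ∀ i j, i < j → g.val i j = 0}
  one_mem' := by
    refine ⟨fun i => by simp, fun i j hij => ?_⟩
    simp [Matrix.one_apply_ne hij.ne]
  mul_mem' := by
    rintro a b ⟨ha, ha'⟩ ⟨hb, hb'⟩
    refine ⟨fun i => ?_, fun i j hij => ?_⟩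
    · rw [Units.val_mul, Matrix.mul_apply, Finset.sum_eq_single i, ha, hb, one_mul]
      · intro m _ hm
        rcases lt_or_gt_of_ne hm with h | h
        · rw [hb' m i h, mul_zero]
        · rw [ha' i m h, zero_mul]
      · simp
    · rw [Units.val_mul, Matrix.mul_apply]
      refine Finset.sum_eq_zero fun m _ => ?_
      rcases lt_or_ge i m with h | h
      · rw [ha' i m h, zero_mul]
      · rw [hb' m j (h.trans_lt hij), mul_zero]
  inv_mem' := by
    rintro a ⟨ha, ha'⟩
    have key : ∀ i j, i < j → (a⁻¹).val i j = 0 := by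
      have hT : Matrix.BlockTriangular a.val OrderDual.toDual := fun i j h => ha' i j h
      haveI : Invertible a.val := a.invertible
      have h2 := Matrix.blockTriangular_inv_of_blockTriangular hT
      rw [← Matrix.coe_units_inv] at h2
      exact fun i j hij => h2 hij
    refine ⟨fun i => ?_, key⟩
    have h1 : (a.val * (a⁻¹).val) i i = 1 := by
      rw [← Units.val_mul, mul_inv_cancel, Units.val_one, Matrix.one_apply_eq]
    rw [Matrix.mul_apply, Finset.sum_eq_single i, ha, one_mul] at h1
    · exact h1
    · intro m _ hm
      rcases lt_or_gt_of_ne hm with h | h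
      · rw [key m i h, mul_zero]
      · rw [ha' i m h, zero_mul]
    · simp

/-- The `k`-th term `γ_k(G)` of the lower central series of `G`, for `k ≥ 1`:
`γ_1(G) = G` and `γ_{k+1}(G) = [γ_k(G), G]`. Mathlib's indexing starts at `0`. -/
abbrev lcsTerm (k : ℕ) (G : Type*) [Group G] : Subgroup G :=
  (⊤ : Subgroup G).lowerCentralSeries (k - 1)

/-- The factor group `Γ_{n,k} = UT_n(K) / γ_k(UT_n(K))`. -/
abbrev GammaGroup (n k : ℕ) (K : Type*) [Field K] : Type _ :=
  UT n K ⧸ lcsTerm k (UT n K)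

/-- The group `Aut_c(G)` of class preserving automorphisms of `G`: those automorphisms `φ` such
that `φ x` is conjugate to `x` for every `x`. -/
def AutC (G : Type*) [Group G] : Subgroup (MulAut G) where
  carrier := {φ | ∀ x : G, IsConj x (φ x)}
  one_mem' := fun x => IsConj.refl x
  mul_mem' := fun {a b} ha hb x => (hb x).trans (ha (b x))
  inv_mem' := fun {a} ha x => by
    have h := ha (a⁻¹ x)
    rw [MulAut.apply_inv_self] at h
    exact h.symm

/-- The group `Inn(G)` of inner automorphisms of `G`. -/
def Inn (G : Type*) [Group G] : Subgroup (MulAut G) :=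
  (MulAut.conj : G →* MulAut G).range

/-- `K` is a prime field: it has no proper subfield. -/
def IsPrimeField (K : Type*) [Field K] : Prop :=
  ∀ F : Subfield K, F = ⊤

/-!
Write `N_k` for the group of unitriangular matrices whose first `k - 1` subdiagonals vanish. Since
`⁅1 + t E_{ac}, 1 + E_{cb}⁆ = 1 + t E_{ab}`, and since `N_k` is generated by the elementary matrices
on the subdiagonals from the `k`-th on, `N_k` is the `k`-th term of the lower central series
(`UT.lcsTerm_eq`). Hence elements of `Γ_{n,k}` are matrices whose entries `(i, j)` matter only for
`i < j + k`, and `y` is conjugate to `x` iff `h x ≡ y h` for some `h`. Rows and columns are numbered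
from `0`.

If `K` is not prime, there is an additive map `g : K → K` which is not multiplication by a
constant. The map `x ↦ x (1 + g (x_{k-1,k-2}) E_{k-1,0})` is an automorphism of `Γ_{n,k}`, since the
second factor is central (`UT.shear`). It preserves conjugacy classes: conjugation by
`1 + t E_{k-2,0}` multiplies `x` by `1 - t x_{k-1,k-2} E_{k-1,0}`, and `t` can be chosen depending
on `x` as soon as `x_{k-1,k-2} ≠ 0`. It is not inner, since conjugation by `h` would force `g` to be
multiplication by `-h_{k-2,0}`.

If `K` is prime, all additive maps `K → K` are multiplications by constants. A class preserving
map of `Γ_{n,k+1}` induces one of `Γ_{n,k}`, which is inner by induction, so it may be assumed to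
have the form `x ↦ x + D(x)` with `D(x)` on the `k`-th subdiagonal and `D` additive. Everything is
then determined by `D` on `1 + t E_{i+1,i}`, where it is linear in `t`. Being conjugate to `x` means
`D(x) = h x - x h` for some `h = h_x`. For `x = 1 + t E_{i+1,i}` this leaves only the two entries
`(i+k, i)` and `(i+1, i+1-k)`; for `x = (1 + E_{i+1,i}) (1 + E_{i+k+1,i+k})` it says that the entry
`(i+k, i)` of the first factor is the negative of the entry `(i+k+1, i+1)` of the second, both
being, up to sign, the entry `(i+k, i+1)` of the same `h`. These common values, placed on
subdiagonal `k - 1`, define a single `h` that works for all `x` (`UT.exists_conj_of_congr`).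
-/

namespace UT

open Matrix
open scoped commutatorElement

/-! ### Congruence modulo the subdiagonals from the `k`-th on -/

variable {n : ℕ} {K : Type*}

/-- `A ≡ B` modulo the subdiagonals from the `k`-th on: the entries `(i, j)` with `i < j + k` agree.
The inequality is written without subtraction, so it includes all entries on and above the
diagonal. -/
def CongrMod (k : ℕ) (A B : Matrix (Fin n) (Fin n) K) : Prop :=
  ∀ i j : Fin n, (i : ℕ) < j + k → A i j = B i j

namespace CongrMod

variable {k : ℕ} {A B C : Matrix (Fin n) (Fin n) K}

theorem refl (A : Matrix (Fin n) (Fin n) K) : CongrMod k A A := fun _ _ _ => rfl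

theorem symm (h : CongrMod k A B) : CongrMod k B A := fun i j hij => (h i j hij).symm

theorem trans (h : CongrMod k A B) (h' : CongrMod k B C) : CongrMod k A C :=
  fun i j hij => (h i j hij).trans (h' i j hij)

theorem mono {l : ℕ} (hl : l ≤ k) (h : CongrMod k A B) : CongrMod l A B :=
  fun i j hij => h i j (by omega)

end CongrMod

variable [Field K]

/-- The underlying matrix of an element of `UT n K`. -/
abbrev mat (x : UT n K) : Matrix (Fin n) (Fin n) K := x.1.val

theorem mat_mul (x y : UT n K) : mat (x * y) = mat x * mat y := rfl

theorem mat_one : mat (1 : UT n K) = 1 := rfl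

theorem mat_injective : Function.Injective (mat : UT n K → Matrix (Fin n) (Fin n) K) :=
  fun _ _ h => Subtype.ext (Units.ext h)

theorem mat_diag (x : UT n K) (i : Fin n) : mat x i i = 1 := x.2.1 i

theorem mat_upper (x : UT n K) {i j : Fin n} (h : i < j) : mat x i j = 0 := x.2.2 i j h

theorem exists_mat_eq (A : Matrix (Fin n) (Fin n) K) (hd : ∀ i, A i i = 1)
    (hu : ∀ i j, i < j → A i j = 0) : ∃ x : UT n K, mat x = A := by
  have hdet : A.det = 1 := by
    rw [Matrix.det_of_isLowerTriangular A (fun i j h => hu i j h)]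
    simp [hd]
  exact ⟨⟨Matrix.GeneralLinearGroup.mkOfDetNeZero A (by simp [hdet]), hd, hu⟩, rfl⟩

namespace CongrMod

variable {k : ℕ} {A B : Matrix (Fin n) (Fin n) K}

theorem mul_right (h : CongrMod k A B) (x : UT n K) : CongrMod k (A * mat x) (B * mat x) := by
  intro i j hij
  rw [mul_apply, mul_apply]
  refine Finset.sum_congr rfl fun l _ => ?_
  rcases lt_or_ge l j with hl | hl
  · rw [mat_upper x hl, mul_zero, mul_zero]
  · rw [h i l (by have := Fin.le_def.1 hl; omega)]

theorem mul_left (h : CongrMod k A B) (x : UT n K) : CongrMod k (mat x * A) (mat x * B) := by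
  intro i j hij
  rw [mul_apply, mul_apply]
  refine Finset.sum_congr rfl fun l _ => ?_
  rcases lt_or_ge i l with hl | hl
  · rw [mat_upper x hl, zero_mul, zero_mul]
  · rw [h l j (by have := Fin.le_def.1 hl; omega)]

theorem mul {x x' y y' : UT n K} (h : CongrMod k (mat x) (mat x'))
    (h' : CongrMod k (mat y) (mat y')) : CongrMod k (mat (x * y)) (mat (x' * y')) :=
  (h.mul_right y).trans (h'.mul_left x')

theorem inv_mul_iff {x y : UT n K} :
    CongrMod k (mat (x⁻¹ * y)) 1 ↔ CongrMod k (mat x) (mat y) := by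
  constructor
  · intro h
    have := h.mul_left x
    rw [← mat_mul, mul_inv_cancel_left, mul_one] at this
    exact this.symm
  · intro h
    have := h.symm.mul_left x⁻¹
    rw [← mat_mul, ← mat_mul, inv_mul_cancel] at this
    exact this

end CongrMod

variable (n K) in
/-- The group `N_k` of unitriangular matrices whose first `k - 1` subdiagonals vanish. -/
def congrSubgroup (k : ℕ) : Subgroup (UT n K) where
  carrier := {x | CongrMod k (mat x) 1}
  one_mem' := CongrMod.refl _
  mul_mem' {x y} hx hy := by
    have := CongrMod.mul (x' := 1) (y' := 1) hx hy
    rwa [mul_one, mat_one] at this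
  inv_mem' {x} hx := by
    have := CongrMod.inv_mul_iff (x := x) (y := 1) (k := k)
    rw [mul_one] at this
    exact this.2 hx

theorem mem_congrSubgroup {k : ℕ} {x : UT n K} :
    x ∈ congrSubgroup n K k ↔ CongrMod k (mat x) 1 := Iff.rfl

theorem congrSubgroup_one : congrSubgroup n K 1 = ⊤ := by
  refine top_unique fun x _ i j hij => ?_
  rcases eq_or_ne i j with rfl | h
  · rw [mat_diag, one_apply_eq]
  · rw [one_apply_ne h, mat_upper x (lt_of_le_of_ne (Fin.le_def.2 (by omega)) h)]

/-! ### Elementary matrices and the lower central series -/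

theorem single_mul_apply_eq_ite (a b : Fin n) (t : K) (A : Matrix (Fin n) (Fin n) K) (i j : Fin n) :
    (single a b t * A) i j = if i = a then t * A b j else 0 := by
  split_ifs with h
  · subst h; simp
  · rw [single_mul_apply_of_ne _ _ _ _ _ h]

theorem mul_single_apply_eq_ite (a b : Fin n) (t : K) (A : Matrix (Fin n) (Fin n) K) (i j : Fin n) :
    (A * single a b t) i j = if j = b then A i a * t else 0 := by
  split_ifs with h
  · subst h; simp
  · rw [mul_single_apply_of_ne _ _ _ _ _ h]

theorem single_apply_eq_ite (a b : Fin n) (t : K) (i j : Fin n) :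
    single a b t i j = if i = a ∧ j = b then t else 0 := by
  rw [single_apply]; simp only [eq_comm]

theorem exists_elem {a b : Fin n} (h : b < a) (t : K) :
    ∃ x : UT n K, mat x = 1 + single a b t := by
  refine exists_mat_eq _ (fun i => ?_) fun i j hij => ?_
  · rw [Matrix.add_apply, one_apply_eq, single_apply_eq_ite,
      if_neg (by rintro ⟨rfl, rfl⟩; exact h.false), add_zero]
  · rw [Matrix.add_apply, one_apply_ne hij.ne, single_apply_eq_ite,
      if_neg (by rintro ⟨rfl, rfl⟩; exact h.not_gt hij), add_zero]

/-- The elementary matrix `1 + t E_{ab}` for `b < a`, as an element of `UT n K`. -/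
noncomputable def elem {a b : Fin n} (h : b < a) (t : K) : UT n K := (exists_elem h t).choose

theorem mat_elem {a b : Fin n} (h : b < a) (t : K) : mat (elem h t) = 1 + single a b t :=
  (exists_elem h t).choose_spec

theorem elem_add {a b : Fin n} (h : b < a) (s t : K) : elem h (s + t) = elem h s * elem h t := by
  apply mat_injective
  rw [mat_mul, mat_elem, mat_elem, mat_elem, single_add]
  simp only [mul_add, add_mul, one_mul, mul_one]
  rw [single_mul_single_of_ne _ _ _ _ h.ne]
  abel

theorem elem_zero {a b : Fin n} (h : b < a) : elem h (0 : K) = 1 :=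
  mat_injective (by rw [mat_elem, single_zero, add_zero, mat_one])

theorem commutator_elem {a b c : Fin n} (hca : c < a) (hbc : b < c) (t : K) :
    ⁅elem hca t, elem hbc 1⁆ = elem (hbc.trans hca) t := by
  rw [commutatorElement_def, mul_inv_eq_iff_eq_mul, mul_inv_eq_iff_eq_mul]
  apply mat_injective
  simp only [mat_mul, mat_elem, mul_add, add_mul, one_mul, mul_one]
  rw [single_mul_single_same, single_mul_single_of_ne _ _ _ _ (hbc.trans hca).ne,
    single_mul_single_of_ne _ _ _ _ hbc.ne, single_mul_single_of_ne _ _ _ _ (hbc.trans hca).ne]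
  simp only [mul_one, zero_mul]
  abel

theorem elem_mem_congrSubgroup {a b : Fin n} (h : b < a) (t : K) {k : ℕ} (hk : (b : ℕ) + k ≤ a) :
    elem h t ∈ congrSubgroup n K k := by
  intro i j hij
  rw [mat_elem, Matrix.add_apply, single_apply_eq_ite, if_neg (by rintro ⟨rfl, rfl⟩; omega),
    add_zero]

/-- `N_k` is generated by the elementary matrices on the subdiagonals from the `k`-th on. The
entries below the diagonal are cleared in the order of `(i - j) * n + j`, one subdiagonal after
another: left multiplication by `1 + t E_{ab}` changes only the entry `(a, b)` and entries of row
`a` that come later. -/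
theorem congrSubgroup_le_of_elem_mem {k : ℕ} (hk : 1 ≤ k) (S : Subgroup (UT n K))
    (hS : ∀ (a b : Fin n) (h : b < a), (b : ℕ) + k ≤ a → ∀ t, elem h t ∈ S) :
    congrSubgroup n K k ≤ S := by
  have key : ∀ r N : ℕ, N + r = n * n → k * n ≤ N → ∀ x : UT n K,
      (∀ i j : Fin n, j < i → ((i : ℕ) - j) * n + j < N → mat x i j = 0) → x ∈ S := by
    intro r
    induction r with
    | zero =>
      intro N hN _ x hx
      have : x = 1 := by
        apply mat_injective
        ext i j
        rw [mat_one]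
        rcases lt_trichotomy i j with h | rfl | h
        · rw [mat_upper x h, one_apply_ne h.ne]
        · rw [mat_diag, one_apply_eq]
        · rw [one_apply_ne h.ne', hx i j h]
          have h1 : ((i : ℕ) - j) + 1 ≤ n := by omega
          have h2 := Nat.mul_le_mul_right n h1
          have := j.2
          rw [add_mul] at h2
          omega
      rw [this]
      exact one_mem _
    | succ r ih =>
      intro N hN hkN x hx
      have hn : 0 < n := by
        rcases Nat.eq_zero_or_pos n with rfl | h
        · omega
        · exact h
      have hdec : N / n * n + N % n = N := by rw [mul_comm]; exact Nat.div_add_mod N n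
      have hmod : N % n < n := Nat.mod_lt _ hn
      have hdk : k ≤ N / n := (Nat.le_div_iff_mul_le hn).2 hkN
      have huniq : ∀ i j : Fin n, j < i → ((i : ℕ) - j) * n + j = N →
          (j : ℕ) = N % n ∧ (i : ℕ) = N % n + N / n := by
        intro i j hij h
        have h1 : (j : ℕ) = N % n := by
          rw [← h, Nat.mul_add_mod_self_right, Nat.mod_eq_of_lt j.2]
        have h2 : (i : ℕ) - j = N / n := by
          rw [← h, mul_comm, Nat.mul_add_div hn, Nat.div_eq_of_lt j.2, add_zero]
        have := Fin.lt_def.1 hij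
        omega
      by_cases hlt : N % n + N / n < n
      · set b : Fin n := ⟨N % n, hmod⟩ with hb
        set a : Fin n := ⟨N % n + N / n, hlt⟩ with ha
        have hba : b < a := Fin.lt_def.2 (by simp only [hb, ha]; omega)
        have hT : elem hba (-mat x a b) ∈ S := hS a b hba (by simp only [hb, ha]; omega) _
        rw [← S.mul_mem_cancel_left hT]
        refine ih (N + 1) (by omega) (by omega) _ fun i j hij hlt' => ?_
        rw [mat_mul, mat_elem, add_mul, one_mul, Matrix.add_apply, single_mul_apply_eq_ite]
        rcases Nat.lt_succ_iff_lt_or_eq.1 hlt' with h | h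
        · rw [hx i j hij h, zero_add]
          split_ifs with hia
          · rcases lt_trichotomy b j with hbj | hbj | hbj
            · rw [mat_upper x hbj, mul_zero]
            · exfalso
              rw [hia, ← hbj] at h
              simp only [hb, ha, Nat.add_sub_cancel_left] at h
              omega
            · rw [hx b j hbj, mul_zero]
              refine lt_of_le_of_lt ?_ h
              gcongr
              rw [hia]
              exact Fin.le_def.1 hba.le
          · rfl
        · obtain ⟨h1, h2⟩ := huniq i j hij h
          have hj : j = b := Fin.ext h1
          have hi : i = a := Fin.ext h2
          rw [if_pos hi, hi, hj, mat_diag, mul_one, add_neg_cancel]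
      · refine ih (N + 1) (by omega) (by omega) x fun i j hij hlt' => ?_
        rcases Nat.lt_succ_iff_lt_or_eq.1 hlt' with h | h
        · exact hx i j hij h
        · have := (huniq i j hij h).2
          omega
  intro x hx
  by_cases hkn : k ≤ n
  · have hle := Nat.mul_le_mul_right n hkn
    refine key (n * n - k * n) (k * n) (by omega) le_rfl x fun i j hij hlt => ?_
    rw [hx i j, one_apply_ne hij.ne']
    have : (i : ℕ) - j < k :=
      lt_of_mul_lt_mul_right (by omega : ((i : ℕ) - j) * n < k * n) (by omega)
    omega
  · have : x = 1 := by
      apply mat_injective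
      ext i j
      exact hx i j (by omega)
    rw [this]
    exact one_mem _

/-- A matrix with no entries above the `k`-th subdiagonal is changed by unitriangular factors only
below that subdiagonal. -/
theorem congrMod_succ_mul_comm {k : ℕ} {A : Matrix (Fin n) (Fin n) K} (hA : CongrMod k A 0)
    (y : UT n K) : CongrMod (k + 1) (A * mat y) A ∧ CongrMod (k + 1) (mat y * A) A := by
  constructor
  · intro i j hij
    rw [mul_apply, Finset.sum_eq_single j, mat_diag, mul_one]
    · intro l _ hl
      rcases lt_or_gt_of_ne hl with h | h
      · rw [mat_upper y h, mul_zero]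
      · rw [hA i l (by have := Fin.lt_def.1 h; omega), Matrix.zero_apply, zero_mul]
    · simp
  · intro i j hij
    rw [mul_apply, Finset.sum_eq_single i, mat_diag, one_mul]
    · intro l _ hl
      rcases lt_or_gt_of_ne hl with h | h
      · rw [hA l j (by have := Fin.lt_def.1 h; omega), Matrix.zero_apply, mul_zero]
      · rw [mat_upper y h, zero_mul]
    · simp

theorem congrMod_mul_comm {k : ℕ} {x : UT n K} (hx : x ∈ congrSubgroup n K k) (y : UT n K) :
    CongrMod (k + 1) (mat (x * y)) (mat (y * x)) := by
  obtain ⟨h1, h2⟩ := congrMod_succ_mul_comm (A := mat x - 1)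
    (fun i j hij => by rw [Matrix.sub_apply, hx i j hij, sub_self, Matrix.zero_apply]) y
  intro i j hij
  have := (h1 i j hij).trans (h2 i j hij).symm
  rw [sub_mul, mul_sub, one_mul, mul_one, Matrix.sub_apply, Matrix.sub_apply, sub_left_inj] at this
  exact this

/-- The `k`-th term of the lower central series, in Mathlib's numbering from `0`, is `N_{k+1}`. -/
theorem lowerCentralSeries_eq (k : ℕ) :
    (⊤ : Subgroup (UT n K)).lowerCentralSeries k = congrSubgroup n K (k + 1) := by
  induction k with
  | zero => rw [Subgroup.lowerCentralSeries_zero, congrSubgroup_one]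
  | succ k ih =>
    rw [Subgroup.lowerCentralSeries_succ, ih]
    apply le_antisymm
    · rw [Subgroup.commutator_le]
      intro x hx y _
      have h := (congrMod_mul_comm hx y).mul_right (y * x)⁻¹
      rw [← mat_mul, ← mat_mul, mul_inv_cancel, mat_one, _root_.mul_inv_rev,
        ← mul_assoc] at h
      exact h
    · refine congrSubgroup_le_of_elem_mem (by omega) _ fun a b h hab t => ?_
      have hc : (b : ℕ) + 1 < n := by omega
      set c : Fin n := ⟨b + 1, hc⟩ with hcdef
      have hbc : b < c := Fin.lt_def.2 (by simp [hcdef])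
      have hca : c < a := Fin.lt_def.2 (by simp only [hcdef]; omega)
      rw [← commutator_elem hca hbc t]
      exact Subgroup.commutator_mem_commutator
        (elem_mem_congrSubgroup _ _ (by simp only [hcdef]; omega)) (Subgroup.mem_top _)

theorem lcsTerm_eq {k : ℕ} (hk : 1 ≤ k) : lcsTerm k (UT n K) = congrSubgroup n K k := by
  rw [lcsTerm, lowerCentralSeries_eq, Nat.sub_add_cancel hk]

theorem mk_eq_mk_iff {k : ℕ} (hk : 1 ≤ k) (x y : UT n K) :
    (QuotientGroup.mk x : GammaGroup n k K) = QuotientGroup.mk y ↔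
      CongrMod k (mat x) (mat y) := by
  rw [QuotientGroup.eq, lcsTerm_eq hk, mem_congrSubgroup, CongrMod.inv_mul_iff]

theorem isConj_mk_iff {k : ℕ} (hk : 1 ≤ k) (x y : UT n K) :
    IsConj (QuotientGroup.mk x : GammaGroup n k K) (QuotientGroup.mk y) ↔
      ∃ h : UT n K, CongrMod k (mat (h * x)) (mat (y * h)) := by
  rw [isConj_iff]
  constructor
  · rintro ⟨c, hc⟩
    induction c using QuotientGroup.induction_on with | H h => ?_
    refine ⟨h, (mk_eq_mk_iff hk _ _).1 ?_⟩
    rw [mul_inv_eq_iff_eq_mul] at hc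
    exact hc
  · rintro ⟨h, hh⟩
    refine ⟨QuotientGroup.mk h, ?_⟩
    rw [mul_inv_eq_iff_eq_mul]
    exact (mk_eq_mk_iff hk _ _).2 hh

/-- `UT n K` is generated by the elementary matrices on the first subdiagonal. -/
theorem eq_top_of_elem_mem (S : Subgroup (UT n K))
    (hS : ∀ (a b : Fin n) (h : b < a), (a : ℕ) = b + 1 → ∀ t, elem h t ∈ S) : S = ⊤ := by
  rw [← top_le_iff, ← congrSubgroup_one]
  refine congrSubgroup_le_of_elem_mem le_rfl _ fun a b h _ => ?_
  obtain ⟨d, hd⟩ : ∃ d, (a : ℕ) = b + 1 + d := ⟨a - (b + 1), by have := Fin.lt_def.1 h; omega⟩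
  induction d generalizing b with
  | zero => exact hS a b h hd
  | succ d ih =>
    intro t
    have hc : (b : ℕ) + 1 < n := by omega
    set c : Fin n := ⟨b + 1, hc⟩ with hcdef
    have hbc : b < c := Fin.lt_def.2 (by simp [hcdef])
    have hca : c < a := Fin.lt_def.2 (by simp only [hcdef]; omega)
    have h1 := ih c hca (by simp only [hcdef]; omega) (by simp only [hcdef]; omega) t
    have h2 := hS c b hbc rfl 1
    rw [← commutator_elem hca hbc t, commutatorElement_def]
    exact mul_mem (mul_mem (mul_mem h1 h2) (inv_mem h1)) (inv_mem h2)

/-! ### Non-prime fields: a class preserving automorphism that is not inner -/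

section NonPrime

/-- Over a proper subfield `F` and for `x ∉ F`, an `F`-linear functional that kills `1` but not `x`
is not multiplication by a constant. -/
theorem exists_addMonoidHom_ne_mul (hK : ¬ IsPrimeField K) :
    ∃ g : K →+ K, ∀ c, ∃ a, g a ≠ a * c := by
  obtain ⟨F, hF⟩ := not_forall.1 hK
  obtain ⟨x, hx⟩ : ∃ x, x ∉ F := by
    by_contra! h
    exact hF (top_unique fun x _ => h x)
  have hx' : x ∉ Submodule.span F {(1 : K)} := by
    rw [Submodule.mem_span_singleton]
    rintro ⟨a, rfl⟩
    exact hx (by rw [Subfield.smul_def, smul_eq_mul, mul_one]; exact a.2)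
  obtain ⟨f, hfx, hf⟩ := Submodule.exists_le_ker_of_notMem hx'
  refine ⟨(F.subtype : F →+ K).comp f.toAddMonoidHom, fun c => ?_⟩
  by_contra! h
  have h1 : f 1 = 0 := hf (Submodule.mem_span_singleton_self 1)
  have hc : c = 0 := by
    have := h 1
    simpa [h1] using this.symm
  have := h x
  rw [hc, mul_zero] at this
  exact hfx (by simpa using this)

variable {k : ℕ} {r s o : Fin n}

/-- The entries on the first subdiagonal are additive characters of `UT n K`. -/
theorem mat_mul_apply_succ (x y : UT n K) (h : (r : ℕ) = s + 1) :
    mat (x * y) r s = mat x r s + mat y r s := by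
  have hsr : s < r := Fin.lt_def.2 (by omega)
  rw [mat_mul, mul_apply, Finset.sum_eq_add r s hsr.ne', mat_diag, mat_diag, one_mul, mul_one,
    add_comm]
  · intro l _ hl
    rcases lt_or_gt_of_ne hl.1 with h1 | h1
    · have : l < s := lt_of_le_of_ne (Fin.le_def.2 (by have := Fin.lt_def.1 h1; omega)) hl.2
      rw [mat_upper y this, mul_zero]
    · rw [mat_upper x h1, zero_mul]
  · simp
  · simp

/-- The endomorphism `x ↦ x (1 + g (x_{rs}) E_{ro})` of `Γ_{n,k}`, where `r = k - 1`, `s = k - 2`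
and `o = 0`, for an additive map `g : K → K`. The indices are elements of `Fin n` with prescribed
values. -/
noncomputable def shear (hk : 2 ≤ k) (hr : (r : ℕ) + 1 = k) (hrs : (r : ℕ) = s + 1)
    (ho : (o : ℕ) = 0) (hor : o < r) (g : K →+ K) : GammaGroup n k K →* GammaGroup n k K :=
  QuotientGroup.lift _
    (MonoidHom.mk' (fun x => (QuotientGroup.mk (x * elem hor (g (mat x r s))) : GammaGroup n k K))
      fun x y => by
        rw [← QuotientGroup.mk_mul, mk_eq_mk_iff (by omega), mat_mul_apply_succ x y hrs, map_add,
          elem_add]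
        have h := congrMod_mul_comm (elem_mem_congrSubgroup hor (g (mat x r s))
          (k := k - 1) (by omega)) y
        rw [Nat.sub_add_cancel (by omega)] at h
        have h' := (h.mul_left x).mul_right (elem hor (g (mat y r s)))
        simp only [← mat_mul, mul_assoc] at h' ⊢
        exact h'.symm)
    fun x hx => by
      rw [lcsTerm_eq (by omega)] at hx
      have h0 : mat x r s = 0 := by
        rw [hx r s (by omega), one_apply_ne (by rintro rfl; omega)]
      change (QuotientGroup.mk (x * elem hor (g (mat x r s))) : GammaGroup n k K) =
        QuotientGroup.mk 1
      rw [mk_eq_mk_iff (by omega), h0, map_zero, elem_zero, mul_one]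
      exact hx

theorem shear_mk (hk : 2 ≤ k) (hr : (r : ℕ) + 1 = k) (hrs : (r : ℕ) = s + 1)
    (ho : (o : ℕ) = 0) (hor : o < r) (g : K →+ K) (x : UT n K) :
    shear hk hr hrs ho hor g (QuotientGroup.mk x) =
      QuotientGroup.mk (x * elem hor (g (mat x r s))) := rfl

theorem shear_shear (hk : 2 ≤ k) (hr : (r : ℕ) + 1 = k) (hrs : (r : ℕ) = s + 1)
    (ho : (o : ℕ) = 0) (hor : o < r) (hos : o ≠ s) (g g' : K →+ K) (hg : g + g' = 0) :
    (shear hk hr hrs ho hor g).comp (shear hk hr hrs ho hor g') = MonoidHom.id _ := by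
  ext x
  change shear hk hr hrs ho hor g (shear hk hr hrs ho hor g' (QuotientGroup.mk x)) =
    QuotientGroup.mk x
  have hel : mat (elem hor (g' (mat x r s))) r s = 0 := by
    rw [mat_elem, Matrix.add_apply, one_apply_ne (by rintro rfl; omega), single_apply_eq_ite,
      if_neg (fun h => hos h.2.symm), add_zero]
  rw [shear_mk, shear_mk, mat_mul_apply_succ _ _ hrs, hel, add_zero, mul_assoc, ← elem_add,
    add_comm, ← AddMonoidHom.add_apply, hg, AddMonoidHom.zero_apply, elem_zero, mul_one]

/-- If `a = x_{rs}` is nonzero, then conjugation by `1 - (g a / a) E_{so}` sends `x` to its image;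
if `a = 0`, then `x` is fixed. -/
theorem isConj_shear (hk : 2 ≤ k) (hr : (r : ℕ) + 1 = k) (hrs : (r : ℕ) = s + 1)
    (ho : (o : ℕ) = 0) (hor : o < r) (hos : o < s) (g : K →+ K) (x : GammaGroup n k K) :
    IsConj x (shear hk hr hrs ho hor g x) := by
  induction x using QuotientGroup.induction_on with | H x => ?_
  rw [shear_mk]
  rcases eq_or_ne (mat x r s) 0 with h0 | h0
  · rw [h0, map_zero, elem_zero, mul_one]
  rw [isConj_mk_iff (by omega)]
  set a := mat x r s with ha
  refine ⟨elem hos (-g a / a), fun i j hij => ?_⟩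
  have hrow : mat x o j = (1 : Matrix (Fin n) (Fin n) K) o j := by
    rcases eq_or_ne o j with rfl | h
    · rw [mat_diag, one_apply_eq]
    · rw [one_apply_ne h, mat_upper x (Fin.lt_def.2 (by
        have := fun e => h (Fin.ext e); omega))]
  simp only [mat_mul, mat_elem, mul_add, add_mul, mul_one, one_mul, Matrix.add_apply,
    single_mul_apply_eq_ite, mul_single_apply_eq_ite, hrow]
  rcases eq_or_ne j o with rfl | hj
  · have hir : i ≤ r := Fin.le_def.2 (by omega)
    have hsr : s < r := Fin.lt_def.2 (by omega)
    simp only [if_true, one_apply_eq, if_neg hos.ne', zero_mul, add_zero, mul_one]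
    rcases eq_or_lt_of_le hir with rfl | hir
    · rw [if_neg hsr.ne', mat_diag, ← ha]
      field_simp
      ring
    · rw [mat_upper x hir, zero_mul, add_zero]
      have his : i ≤ s := Fin.le_def.2 (by have := Fin.lt_def.1 hir; omega)
      rcases eq_or_lt_of_le his with rfl | his
      · rw [if_pos rfl, mat_diag, one_mul]
      · rw [if_neg his.ne, mat_upper x his, zero_mul]
  · simp only [one_apply_ne hj.symm, mul_zero, ite_self, if_neg hj, add_zero]

/-- If `shear g` is conjugation by `h`, comparison of the entries `(r, o)` for the elements
`1 + a E_{rs}` shows `g a = -a h_{so}`. -/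
theorem shear_not_inner (hk : 2 ≤ k) (hr : (r : ℕ) + 1 = k) (hrs : (r : ℕ) = s + 1)
    (ho : (o : ℕ) = 0) (hor : o < r) (hos : o < s) (g : K →+ K) (h : GammaGroup n k K)
    (hh : ∀ x, shear hk hr hrs ho hor g x = h * x * h⁻¹) : ∃ c, ∀ a, g a = a * c := by
  induction h using QuotientGroup.induction_on with | H h => ?_
  have hsr : s < r := Fin.lt_def.2 (by omega)
  refine ⟨-mat h s o, fun a => ?_⟩
  have h1 := hh (QuotientGroup.mk (elem hsr a))
  have h2 : mat (elem hsr a) r s = a := by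
    rw [mat_elem, Matrix.add_apply, one_apply_ne hsr.ne', single_apply_eq_ite, if_pos ⟨rfl, rfl⟩,
      zero_add]
  rw [eq_mul_inv_iff_mul_eq, shear_mk, h2] at h1
  have h3 := (mk_eq_mk_iff (by omega) _ _).1 h1 r o (by omega)
  simp only [mat_mul, mat_elem, mul_add, add_mul, mul_one, one_mul, Matrix.add_apply] at h3
  rw [single_mul_single_of_ne _ _ _ _ hsr.ne, zero_mul, single_mul_apply_eq_ite,
    single_mul_apply_eq_ite, mul_single_apply_eq_ite, if_pos rfl, if_pos rfl,
    if_neg hos.ne, mat_diag, Matrix.zero_apply] at h3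
  linear_combination h3

theorem autC_ne_inn (hK : ¬ IsPrimeField K) (hk : 3 ≤ k) (hkn : k ≤ n) :
    AutC (GammaGroup n k K) ≠ Inn (GammaGroup n k K) := by
  obtain ⟨g, hg⟩ := exists_addMonoidHom_ne_mul hK
  let r : Fin n := ⟨k - 1, by omega⟩
  let s : Fin n := ⟨k - 2, by omega⟩
  let o : Fin n := ⟨0, by omega⟩
  have hr : (r : ℕ) + 1 = k := by simp only [r]; omega
  have hrs : (r : ℕ) = s + 1 := by simp only [r, s]; omega
  have hos : o < s := Fin.lt_def.2 (by simp only [o, s]; omega)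
  have hor : o < r := hos.trans (Fin.lt_def.2 (by omega))
  have hk2 : 2 ≤ k := by omega
  let φ : MulAut (GammaGroup n k K) := MonoidHom.toMulEquiv
    (shear hk2 hr hrs rfl hor g) (shear hk2 hr hrs rfl hor (-g))
    (shear_shear hk2 hr hrs rfl hor hos.ne _ _ (neg_add_cancel g))
    (shear_shear hk2 hr hrs rfl hor hos.ne _ _ (add_neg_cancel g))
  have hφ : φ ∈ AutC (GammaGroup n k K) := fun x => isConj_shear hk2 hr hrs rfl hor hos g x
  intro h
  rw [h] at hφ
  obtain ⟨y, hy⟩ := hφ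
  obtain ⟨c, hc⟩ := shear_not_inner hk2 hr hrs rfl hor hos g y
    fun x => (DFunLike.congr_fun hy x).symm
  obtain ⟨a, ha⟩ := hg c
  exact ha (hc a)

end NonPrime

/-! ### Prime fields: class preserving automorphisms are inner -/

section Prime

theorem _root_.IsPrimeField.addMonoidHom_apply (hK : IsPrimeField K) (g : K →+ K) (t : K) :
    g t = t * g 1 := by
  -- The scalars with respect to which `g` is homogeneous form a subfield.
  let F : Subfield K :=
    { carrier := {t | ∀ s, g (t * s) = t * g s}
      mul_mem' := fun {a b} ha hb s => by rw [mul_assoc, ha, hb, mul_assoc]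
      one_mem' := fun s => by rw [one_mul, one_mul]
      add_mem' := fun {a b} ha hb s => by rw [add_mul, map_add, ha, hb, add_mul]
      zero_mem' := fun s => by rw [zero_mul, map_zero, zero_mul]
      neg_mem' := fun {a} ha s => by rw [neg_mul, map_neg, ha, neg_mul]
      inv_mem' := fun a ha s => by
        rcases eq_or_ne a 0 with rfl | h
        · rw [_root_.inv_zero, zero_mul, map_zero, zero_mul]
        · rw [eq_inv_mul_iff_mul_eq₀ h, ← ha, mul_inv_cancel_left₀ h] }
  have ht : t ∈ F := by rw [hK F]; trivial
  have := ht 1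
  rwa [mul_one] at this

theorem mul_elem_sub_elem_mul_apply (A : Matrix (Fin n) (Fin n) K) {a b : Fin n} (h : b < a)
    (t : K) (p q : Fin n) :
    (A * mat (elem h t)) p q - (mat (elem h t) * A) p q =
      (if q = b then A p a * t else 0) - if p = a then t * A b q else 0 := by
  rw [mat_elem, mul_add, add_mul, mul_one, one_mul, Matrix.add_apply, Matrix.add_apply,
    mul_single_apply_eq_ite, single_mul_apply_eq_ite, add_sub_add_left_eq_sub]

variable {k : ℕ} {F : UT n K → UT n K}

/-- If `F` is multiplicative modulo `k + 1` and the identity modulo `k`, then `F x - x` is additive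
in `x` on the `k`-th subdiagonal. -/
theorem sub_apply_mul (hmul : ∀ x y, CongrMod (k + 1) (mat (F (x * y))) (mat (F x * F y)))
    (hid : ∀ x, CongrMod k (mat (F x)) (mat x)) {p q : Fin n} (hpq : (p : ℕ) = q + k)
    (x y : UT n K) :
    (mat (F (x * y)) - mat (x * y)) p q = (mat (F x) - mat x) p q + (mat (F y) - mat y) p q := by
  have hD : ∀ x, CongrMod k (mat (F x) - mat x) 0 := fun x i j hij => by
    rw [Matrix.sub_apply, hid x i j hij, sub_self, Matrix.zero_apply]
  rw [Matrix.sub_apply, hmul x y p q (by omega),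
    ← (congrMod_succ_mul_comm (hD x) (F y)).1 p q (by omega),
    ← (congrMod_succ_mul_comm (hD y) x).2 p q (by omega), mat_mul, mat_mul, ← Matrix.sub_apply,
    ← Matrix.add_apply, sub_mul, mul_sub, sub_add_sub_cancel]

/-- For `F` the identity modulo `k`, the relation `h x ≡ F x h` modulo `k + 1` reads
`h x - x h = F x - x`: the further term `(F x - x) (h - 1)` lies below the `k`-th subdiagonal. -/
theorem mul_sub_mul_apply (hid : ∀ x, CongrMod k (mat (F x)) (mat x)) (x h : UT n K)
    {p q : Fin n} (hpq : (p : ℕ) < q + (k + 1)) :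
    mat (h * x) p q = mat (F x * h) p q ↔
      (mat h * mat x) p q - (mat x * mat h) p q = (mat (F x) - mat x) p q := by
  have hD : CongrMod k (mat (F x) - mat x) 0 := fun i j hij => by
    rw [Matrix.sub_apply, hid x i j hij, sub_self, Matrix.zero_apply]
  rw [← (congrMod_succ_mul_comm hD h).1 p q hpq, sub_mul, Matrix.sub_apply, sub_left_inj, mat_mul,
    mat_mul]

/-- For `F` multiplicative modulo `k`, the relation `h x ≡ F x h` defines a subgroup of elements
`x`, so it suffices to check it on the elementary matrices of the first subdiagonal. -/
theorem mul_congr_of_elem (hmul : ∀ x y, CongrMod k (mat (F (x * y))) (mat (F x * F y)))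
    (h : UT n K) (he : ∀ (a b : Fin n) (hba : b < a), (a : ℕ) = b + 1 → ∀ t,
      CongrMod k (mat (h * elem hba t)) (mat (F (elem hba t) * h))) (x : UT n K) :
    CongrMod k (mat (h * x)) (mat (F x * h)) := by
  have hone : CongrMod k (mat (F 1)) 1 := by
    have h2 := (hmul 1 1).mul_left (F 1)⁻¹
    rw [← mat_mul, ← mat_mul, inv_mul_cancel_left, mul_one, inv_mul_cancel] at h2
    exact h2.symm
  let S : Subgroup (UT n K) :=
    { carrier := {x | CongrMod k (mat (h * x)) (mat (F x * h))}
      one_mem' := by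
        have := hone.mul_right h
        rw [one_mul, ← mat_mul] at this
        simpa using this.symm
      mul_mem' := fun {x y} hx hy => by
        have h1 := hx.mul_right y
        have h2 := hy.mul_left (F x)
        have h3 := (hmul x y).symm.mul_right h
        simp only [← mat_mul, mul_assoc] at h1 h2 h3
        exact (h1.trans h2).trans h3
      inv_mem' := fun {x} hx => by
        have h1 := (hx.mul_left (F x⁻¹)).mul_right x⁻¹
        have h2 := ((((hmul x⁻¹ x).symm.mul_right h).mul_right x⁻¹))
        have h3 := (hone.mul_right h).mul_right x⁻¹
        rw [one_mul] at h3
        rw [inv_mul_cancel] at h2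
        simp only [← mat_mul, mul_assoc, mul_inv_cancel, mul_one] at h1 h2 h3
        exact ((h1.trans h2).trans h3).symm }
  have hS : S = ⊤ := eq_top_of_elem_mem S he
  have hx : x ∈ S := by rw [hS]; trivial
  exact hx

/-- The inductive step: over a prime field, a class preserving map of `Γ_{n,k+1}` that induces the
identity on `Γ_{n,k}` is inner. The map is given by a lift `F` to matrices. -/
theorem exists_conj_of_congr (hK : IsPrimeField K) (hk : 2 ≤ k)
    (hmul : ∀ x y, CongrMod (k + 1) (mat (F (x * y))) (mat (F x * F y)))
    (hconj : ∀ x, ∃ h : UT n K, CongrMod (k + 1) (mat (h * x)) (mat (F x * h)))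
    (hid : ∀ x, CongrMod k (mat (F x)) (mat x)) :
    ∃ h : UT n K, ∀ x, CongrMod (k + 1) (mat (h * x)) (mat (F x * h)) := by
  set D : UT n K → Matrix (Fin n) (Fin n) K := fun x => mat (F x) - mat x with hDdef
  have hadd : ∀ {p q : Fin n}, (p : ℕ) = q + k → ∀ x y, D (x * y) p q = D x p q + D y p q :=
    fun hpq x y => sub_apply_mul hmul hid hpq x y
  have hcomm : ∀ x, ∃ h : UT n K, ∀ p q : Fin n, (p : ℕ) < q + (k + 1) →
      (mat h * mat x) p q - (mat x * mat h) p q = D x p q := by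
    intro x
    obtain ⟨h, hh⟩ := hconj x
    exact ⟨h, fun p q hpq => (mul_sub_mul_apply hid x h hpq).1 (hh p q hpq)⟩
  -- On `1 + t E_{ab}` a commutator lives in row `a` and column `b`.
  have hvanish : ∀ {a b : Fin n} (h : b < a) (t : K) {p q : Fin n}, (p : ℕ) = q + k →
      q ≠ b → p ≠ a → D (elem h t) p q = 0 := by
    intro a b h t p q hpq hqb hpa
    obtain ⟨g, hg⟩ := hcomm (elem h t)
    rw [← hg p q (by omega), mul_elem_sub_elem_mul_apply, if_neg hqb, if_neg hpa, sub_zero]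
  have hlin : ∀ {a b : Fin n} (h : b < a) (t : K) {p q : Fin n}, (p : ℕ) = q + k →
      D (elem h t) p q = t * D (elem h 1) p q := by
    intro a b h t p q hpq
    exact hK.addMonoidHom_apply (AddMonoidHom.mk' (fun t => D (elem h t) p q)
      fun s t => by rw [elem_add, hadd hpq]) t
  -- Both entries are read off from one commutator with `1 + E_{ab} + E_{p'p}`, up to sign as the
  -- entry `(p, a)` of the conjugating element.
  have hcons : ∀ {a b p p' : Fin n} (h : b < a) (h' : p < p'), (a : ℕ) = b + 1 →
      (p : ℕ) = b + k → (p' : ℕ) = p + 1 → D (elem h 1) p b = -D (elem h' 1) p' a := by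
    intro a b p p' h h' hab hpb hpp
    have hne : ∀ {i j : Fin n}, (i : ℕ) ≠ j → i ≠ j := fun hij e => hij (congrArg _ e)
    obtain ⟨g, hg⟩ := hcomm (elem h 1 * elem h' 1)
    have hmat : mat (elem h 1 * elem h' (1 : K)) = 1 + single a b 1 + single p' p 1 := by
      rw [mat_mul, mat_elem, mat_elem, mul_add, mul_one, add_mul, one_mul,
        single_mul_single_of_ne _ _ _ _ (hne (by omega)), add_zero]
    have h1 := hg p b (by omega)
    have h2 := hg p' a (by omega)
    rw [hadd hpb, hvanish h' 1 hpb (hne (by omega)) (hne (by omega)), add_zero] at h1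
    rw [hadd (by omega), hvanish h 1 (by omega) (hne (by omega)) (hne (by omega)), zero_add] at h2
    rw [← h1, ← h2, hmat]
    simp only [mul_add, add_mul, mul_one, one_mul, Matrix.add_apply, mul_single_apply_eq_ite,
      single_mul_apply_eq_ite]
    rw [if_neg (hne (by omega : (p : ℕ) ≠ a)), if_neg (hne (by omega : (b : ℕ) ≠ p)),
      if_neg (hne (by omega : (p : ℕ) ≠ p')), if_neg (hne (by omega : (a : ℕ) ≠ b)),
      if_neg (hne (by omega : (a : ℕ) ≠ p)), if_neg (hne (by omega : (p' : ℕ) ≠ a))]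
    simp only [if_true]
    ring
  -- The entry `(p, a)` of `h` on subdiagonal `k - 1` is prescribed by the column `b = a - 1`, by
  -- the row `p' = p + 1`, by both (then `hcons` applies), or, at the corner with `k = n`, by
  -- neither.
  have hY : ∀ p a : Fin n, (p : ℕ) + 1 = a + k → ∃ y : K,
      (∀ (b : Fin n) (h : b < a), (a : ℕ) = b + 1 → y = D (elem h 1) p b) ∧
      ∀ (p' : Fin n) (h : p < p'), (p' : ℕ) = p + 1 → y = -D (elem h 1) p' a := by
    intro p a hpa
    by_cases hp : (p : ℕ) + 1 < n
    · refine ⟨-D (elem (Fin.lt_def.2 (Nat.lt_succ_self _) : p < ⟨p + 1, hp⟩) 1) ⟨p + 1, hp⟩ a,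
        fun b h hab => (hcons h _ hab (by omega) rfl).symm, fun p' h hp' => ?_⟩
      obtain rfl : p' = ⟨p + 1, hp⟩ := Fin.ext hp'
      rfl
    · by_cases ha : 1 ≤ (a : ℕ)
      · obtain ⟨c, hc⟩ : ∃ c : Fin n, (a : ℕ) = c + 1 := ⟨⟨a - 1, by omega⟩, by simp only; omega⟩
        refine ⟨D (elem (Fin.lt_def.2 (by omega) : c < a) 1) p c, fun b h hab => ?_,
          fun p' h hp' => by omega⟩
        obtain rfl : b = c := Fin.ext (by omega)
        rfl
      · exact ⟨0, fun b h hab => by omega, fun p' h hp' => by omega⟩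
  choose y hy1 hy2 using hY
  obtain ⟨g, hg⟩ := exists_mat_eq
    (1 + Matrix.of fun p a : Fin n => if h : (p : ℕ) + 1 = a + k then y p a h else 0)
    (fun i => by rw [Matrix.add_apply, one_apply_eq, of_apply, dif_neg (by omega), add_zero])
    (fun i j hij => by
      have := Fin.lt_def.1 hij
      rw [Matrix.add_apply, one_apply_ne hij.ne, of_apply, dif_neg (by omega), add_zero])
  refine ⟨g, mul_congr_of_elem hmul g fun a b hba hab t p q hpq => ?_⟩
  rw [mul_sub_mul_apply hid _ _ hpq, mul_elem_sub_elem_mul_apply]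
  change _ = D (elem hba t) p q
  rcases (by omega : (p : ℕ) < q + k ∨ (p : ℕ) = q + k) with hlt | heq
  · have h0 : D (elem hba t) p q = 0 := sub_eq_zero.2 (hid _ p q hlt)
    rw [h0, hg]
    have h1 : q = b → (1 + Matrix.of fun p a : Fin n =>
        if h : (p : ℕ) + 1 = a + k then y p a h else 0) p a = (1 : Matrix _ _ K) p a := by
      rintro rfl
      rw [Matrix.add_apply, of_apply, dif_neg (by omega), add_zero]
    have h2 : p = a → (1 + Matrix.of fun p a : Fin n =>
        if h : (p : ℕ) + 1 = a + k then y p a h else 0) b q = (1 : Matrix _ _ K) b q := by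
      rintro rfl
      rw [Matrix.add_apply, of_apply, dif_neg (by omega), add_zero]
    by_cases hqb : q = b <;> by_cases hpa : p = a
    · rw [if_pos hqb, if_pos hpa, h1 hqb, h2 hpa, hqb, hpa]; simp
    · rw [if_pos hqb, if_neg hpa, h1 hqb, one_apply_ne hpa]; simp
    · rw [if_neg hqb, if_pos hpa, h2 hpa, one_apply_ne (Ne.symm hqb)]; simp
    · rw [if_neg hqb, if_neg hpa, sub_zero]
  · by_cases hqb : q = b
    · subst hqb
      have hpa : p ≠ a := by rintro rfl; omega
      have hpa' : (p : ℕ) + 1 = a + k := by omega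
      rw [if_pos rfl, if_neg hpa, hg, Matrix.add_apply, one_apply_ne hpa, of_apply, dif_pos hpa',
        hy1 p a hpa' q hba hab, hlin hba t heq]
      ring
    · by_cases hpa : p = a
      · subst hpa
        have hbq : (b : ℕ) + 1 = q + k := by omega
        rw [if_neg hqb, if_pos rfl, hg, Matrix.add_apply, one_apply_ne (Ne.symm hqb), of_apply,
          dif_pos hbq, hy2 b q hbq p hba hab, hlin hba t heq]
        ring
      · rw [if_neg hqb, if_neg hpa, hvanish hba t heq hqb hpa, sub_zero]

/-- Over a prime field, a class preserving endomorphism of `Γ_{n,k}`, given by a lift `F` to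
matrices, is conjugation by some `h`. Stating this for lifts makes `F` itself the lift of the
induced map on `Γ_{n,l}` for all `l ≤ k`, which the induction on `k` uses. -/
theorem exists_conj (hK : IsPrimeField K) {k : ℕ} (hk : 2 ≤ k) (F : UT n K → UT n K)
    (hmul : ∀ x y, CongrMod k (mat (F (x * y))) (mat (F x * F y)))
    (hconj : ∀ x, ∃ h : UT n K, CongrMod k (mat (h * x)) (mat (F x * h))) :
    ∃ h : UT n K, ∀ x, CongrMod k (mat (h * x)) (mat (F x * h)) := by
  induction k, hk using Nat.le_induction generalizing F with
  | base =>
    -- `Γ_{n,2}` is abelian, so conjugate elements are equal.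
    refine ⟨1, fun x => ?_⟩
    obtain ⟨h, hh⟩ := hconj x
    have h1 := (congrMod_mul_comm (k := 1) (x := x) (by rw [congrSubgroup_one]; trivial) h).trans hh
    have h2 := h1.mul_right h⁻¹
    rw [← mat_mul, ← mat_mul, mul_inv_cancel_right, mul_inv_cancel_right] at h2
    rwa [one_mul, mul_one]
  | succ k hk ih =>
    obtain ⟨g, hg⟩ := ih F (fun x y => (hmul x y).mono k.le_succ)
      (fun x => (hconj x).imp fun h hh => hh.mono k.le_succ)
    obtain ⟨h, hh⟩ := exists_conj_of_congr (F := fun x => g⁻¹ * F x * g) hK hk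
      (fun x y => by
        have := ((hmul x y).mul_left g⁻¹).mul_right g
        simp only [← mat_mul] at this
        convert this using 2
        group)
      (fun x => by
        obtain ⟨h, hh⟩ := hconj x
        refine ⟨g⁻¹ * h, ?_⟩
        have := hh.mul_left g⁻¹
        simp only [← mat_mul] at this
        convert this using 2 <;> group)
      (fun x => by
        have := (hg x).symm.mul_left g⁻¹
        simp only [← mat_mul] at this
        convert this using 2 <;> group)
    refine ⟨g * h, fun x => ?_⟩
    have := (hh x).mul_left g
    simp only [← mat_mul] at this
    convert this using 2 <;> group

theorem _root_.Inn_le_AutC (G : Type*) [Group G] : Inn G ≤ AutC G := by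
  rintro _ ⟨g, rfl⟩ x
  exact isConj_iff.2 ⟨g, rfl⟩

theorem autC_eq_inn (hK : IsPrimeField K) {k : ℕ} (hk : 2 ≤ k) :
    AutC (GammaGroup n k K) = Inn (GammaGroup n k K) := by
  refine le_antisymm (fun φ hφ => ?_) (Inn_le_AutC _)
  have hk1 : 1 ≤ k := by omega
  set F : UT n K → UT n K := fun x => (φ (QuotientGroup.mk x)).out with hF
  have hmk : ∀ x, (QuotientGroup.mk (F x) : GammaGroup n k K) = φ (QuotientGroup.mk x) :=
    fun x => QuotientGroup.out_eq' _
  obtain ⟨h, hh⟩ := exists_conj hK hk F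
    (fun x y => by
      rw [← mk_eq_mk_iff hk1, QuotientGroup.mk_mul, hmk, hmk, hmk, ← map_mul, QuotientGroup.mk_mul])
    (fun x => by
      rw [← isConj_mk_iff hk1, hmk]
      exact hφ _)
  refine ⟨QuotientGroup.mk h, ?_⟩
  ext x
  induction x using QuotientGroup.induction_on with | H x => ?_
  rw [MulAut.conj_apply, mul_inv_eq_iff_eq_mul, ← hmk]
  exact (mk_eq_mk_iff hk1 _ _).2 (hh x)

end Prime

end UT

theorem theoremA {K : Type*} [Field K] (n k : ℕ) (hn : 3 ≤ n) (hk : 3 ≤ k) (hkn : k ≤ n) :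
    AutC (GammaGroup n k K) = Inn (GammaGroup n k K) ↔ IsPrimeField K :=
  ⟨fun h => by_contra fun hK => UT.autC_ne_inn hK hk hkn h, fun hK => UT.autC_eq_inn hK (by omega)⟩
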